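/- Let $V$ be a real inner product space of finite dimension $n$, with its Lebesgue measure $\mathrm{Vol}$, and let $q$ be a positive definite quadratic form on $V$. For $a\in V$ and $R\in\mathbb{R}$ put $\mathbb{B}_q(a,R)=\{x\in V : q(x-a)\le R^2\}$. (1) Let $C\subseteq V$ be a closed convex polyhedral cone, that is, an intersection of finitely many closed half-spaces $\{x\in V : (e,x)\ge 0\}$. Then there is a polynomial function $g_{C,q}:\mathbb{R}\times V\to\mathbb{R}$ such that: (a) $g_{C,q}$ is homogeneous of degree $n$; (b) $g_{C,q}(R,a)=g_{C,q}(-R,a)$ for all $(R,a)\in\mathbb{R}\times V$; (c) for all $(R,a)\in\mathbb{R}\times V$ with $q(a)\le R^2$, $$\mathrm{Vol}(C\cap\mathbb{B}_q(a,R))+(-1)^n\,\mathrm{Vol}((-C)\cap\mathbb{B}_q(a,R))=g_{C,q}(R,a).$$ (2) Let $E\subset V$ be a finite set of unit vectors with $E\cap(-E)=\varnothing$, such that $T_0=\{x\in V : (e,x)>0 \text{ for all } e\in E\}$ is non-empty, and let $\mathcal{H}=\{H_e : e\in E\}$, $H_e=\{x\in V : (e,x)=0\}$, be the corresponding central hyperplane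 arrangement with base chamber $T_0$. The chambers of $\mathcal{H}$ are the connected components of $V\setminus\bigcup_{e\in E}H_e$; the sign $(-1)^T$ of a chamber $T$ is $-1$ to the number of $e\in E$ such that $T_0$ and $T$ lie on different sides of $H_e$; and for a measurable set $K\subseteq V$ of finite volume, $P(\mathcal{H},K)=\sum_T(-1)^T\,\mathrm{Vol}(K\cap T)$, the sum being over all chambers $T$ of $\mathcal{H}$. If $|\mathcal{H}|=|E|\equiv n \pmod 2$, then there is a polynomial function $g_{\mathcal{H},q}:\mathbb{R}\times V\to\mathbb{R}$ that is homogeneous of degree $n$, satisfies $g_{\mathcal{H},q}(R,a)=g_{\mathcal{H},q}(-R,a)$ for all $(R,a)\in\mathbb{R}\times V$, and satisfies $$P(\mathcal{H},\mathbb{B}_q(a,R))=g_{\mathcal{H},q}(R,a)$$ for all $(R,a)\in\mathbb{R}\times V$ with $q(a)\le R^2$ (equivalently $0\in\mathbb{B}_q(a,R)$). -/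

import Mathlib

open MeasureTheory Module
open scoped Pointwise RealInnerProductSpace

/-- `f : W → ℝ` is a homogeneous polynomial function of degree `d` on the real vector space `W`:
it is a homogeneous polynomial of degree `d` in finitely many linear forms on `W`. -/
def IsHomogeneousPolynomialFun {W : Type*} [AddCommGroup W] [Module ℝ W]
    (d : ℕ) (f : W → ℝ) : Prop :=
  ∃ (m : ℕ) (ℓ : Fin m → Dual ℝ W) (p : MvPolynomial (Fin m) ℝ),
    p.IsHomogeneous d ∧ ∀ w : W, f w = MvPolynomial.eval (fun i => ℓ i w) p

/-- The ball `{x ∈ V : q (x - a) ≤ R²}` attached to a quadratic form `q`. -/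
def quadBall {V : Type*} [AddCommGroup V] [Module ℝ V]
    (q : QuadraticForm ℝ V) (a : V) (R : ℝ) : Set V :=
  {x | q (x - a) ≤ R ^ 2}

/-- A central hyperplane arrangement in `V` with a base chamber, given by its finite set of unit
normal vectors, no two of which are linearly dependent (for unit vectors: no two of which are
opposite). The normals are oriented towards the base chamber: some point of `V` is strictly on
the positive side of all the hyperplanes. -/
structure CentralArrangement (V : Type*) [NormedAddCommGroup V] [InnerProductSpace ℝ V] where
  /-- the unit normal vectors, one for each hyperplane -/
  normals : Finset V
  norm_eq_one : ∀ e ∈ normals, ‖e‖ = 1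
  neg_notMem : ∀ e ∈ normals, -e ∉ normals
  exists_pos : ∃ x : V, ∀ e ∈ normals, 0 < ⟪e, x⟫

namespace CentralArrangement

variable {V : Type*} [NormedAddCommGroup V] [InnerProductSpace ℝ V]

/-- The hyperplane `H_e` orthogonal to `e`. -/
def hyperplane (e : V) : Set V := {x | ⟪e, x⟫ = 0}

/-- The open half-space bounded by `H_e` that contains `e`. -/
def posSide (e : V) : Set V := {x | 0 < ⟪e, x⟫}

/-- The open half-space bounded by `H_e` that contains `-e`. -/
def negSide (e : V) : Set V := {x | ⟪e, x⟫ < 0}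

/-- The complement in `V` of the union of the hyperplanes of the arrangement. -/
def complement (H : CentralArrangement V) : Set V := (⋃ e ∈ H.normals, hyperplane e)ᶜ

/-- The chambers: the connected components of the complement of the arrangement. -/
def chambers (H : CentralArrangement V) : Set (Set V) :=
  {T | ∃ x ∈ H.complement, T = connectedComponentIn H.complement x}

/-- The base chamber: the one that lies on the positive side of every hyperplane. -/
def baseChamber (H : CentralArrangement V) : Set V := ⋂ e ∈ H.normals, posSide e

/-- The sets `S` and `T` lie on different sides of the hyperplane `H_e`. -/
def Separates (e : V) (S T : Set V) : Prop :=
  (S ⊆ posSide e ∧ T ⊆ negSide e) ∨ (S ⊆ negSide e ∧ T ⊆ posSide e)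

open Classical in
/-- The separation set of two chambers. -/
noncomputable def separationSet (H : CentralArrangement V) (S T : Set V) : Finset V :=
  H.normals.filter (fun e => Separates e S T)

/-- The sign of a chamber. -/
noncomputable def sign (H : CentralArrangement V) (T : Set V) : ℝ :=
  (-1) ^ (H.separationSet H.baseChamber T).card

theorem mem_complement {H : CentralArrangement V} {x : V} :
    x ∈ H.complement ↔ ∀ e ∈ H.normals, ⟪e, x⟫ ≠ 0 := by
  simp [complement, hyperplane]

/-- Points with the same signs with respect to all normals lie in the same chamber. -/
theorem connectedComponentIn_eq_of_signs (H : CentralArrangement V) {x y : V}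
    (hxy : ∀ e ∈ H.normals, 0 < ⟪e, x⟫ * ⟪e, y⟫) :
    connectedComponentIn H.complement x = connectedComponentIn H.complement y := by
  apply connectedComponentIn_eq
  have hseg : segment ℝ x y ⊆ H.complement := by
    rintro z ⟨s, t, hs, ht, hst, rfl⟩
    rw [mem_complement]
    intro e he h0
    have h := hxy e he
    rw [inner_add_right, inner_smul_right, inner_smul_right] at h0
    rcases pos_and_pos_or_neg_and_neg_of_mul_pos h with ⟨h1, h2⟩ | ⟨h1, h2⟩
    · rcases eq_or_lt_of_le hs with rfl | hs'
      · have : t = 1 := by linarith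
        subst this
        linarith
      · nlinarith [mul_pos hs' h1, mul_nonneg ht h2.le]
    · rcases eq_or_lt_of_le hs with rfl | hs'
      · have : t = 1 := by linarith
        subst this
        linarith
      · nlinarith [mul_neg_of_pos_of_neg hs' h1, mul_nonpos_of_nonneg_of_nonpos ht h2.le]
  exact (convex_segment x y).isPreconnected.subset_connectedComponentIn
    (left_mem_segment ℝ x y) hseg (right_mem_segment ℝ x y)

/-- An arrangement has finitely many chambers. -/
theorem finite_chambers (H : CentralArrangement V) : H.chambers.Finite := by
  classical
  have hpow : ((H.normals.powerset : Finset (Finset V)) : Set (Finset V)).Finite :=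
    Finset.finite_toSet _
  have himg : ((fun x => H.normals.filter (fun e => 0 < ⟪e, x⟫)) '' H.complement).Finite :=
    hpow.subset (by
      rintro _ ⟨x, -, rfl⟩
      exact Finset.mem_coe.2 (Finset.mem_powerset.2 (Finset.filter_subset _ _)))
  obtain ⟨s, hs, hs'⟩ : ∃ s : Set V, s ⊆ H.complement ∧ s.Finite ∧
      (fun x => H.normals.filter (fun e => 0 < ⟪e, x⟫)) '' s =
        (fun x => H.normals.filter (fun e => 0 < ⟪e, x⟫)) '' H.complement := by
    obtain ⟨s, h1, h2⟩ := Set.exists_subset_bijOn H.complement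
      (fun x => H.normals.filter (fun e => 0 < ⟪e, x⟫))
    exact ⟨s, h1, Set.Finite.of_finite_image (by rw [h2.image_eq]; exact himg) h2.injOn,
      h2.image_eq⟩
  refine (hs'.1.image (connectedComponentIn H.complement)).subset ?_
  rintro _ ⟨x, hx, rfl⟩
  have hmem := Set.mem_image_of_mem (fun x => H.normals.filter (fun e => 0 < ⟪e, x⟫)) hx
  rw [← hs'.2] at hmem
  obtain ⟨y, hy, hyx⟩ := hmem
  refine ⟨y, hy, H.connectedComponentIn_eq_of_signs ?_⟩
  intro e he
  have h1 : (0 < ⟪e, y⟫) ↔ (0 < ⟪e, x⟫) := by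
    have := Finset.ext_iff.1 hyx e
    simpa [he] using this
  have hx0 := mem_complement.1 hx e he
  have hy0 := mem_complement.1 (hs hy) e he
  rcases lt_or_gt_of_ne hx0 with h | h
  · have : ⟪e, y⟫ < 0 := lt_of_le_of_ne (not_lt.1 fun h' => absurd (h1.1 h') h.not_gt) hy0
    exact mul_pos_of_neg_of_neg this h
  · exact mul_pos (h1.2 h) h

/-- The base chamber is a chamber. -/
theorem baseChamber_mem_chambers (H : CentralArrangement V) : H.baseChamber ∈ H.chambers := by
  obtain ⟨x, hx⟩ := H.exists_pos
  have hb : ∀ z, z ∈ H.baseChamber ↔ ∀ e ∈ H.normals, 0 < ⟪e, z⟫ := by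
    intro z; simp [baseChamber, posSide]
  have hxc : x ∈ H.complement := mem_complement.2 fun e he => (hx e he).ne'
  refine ⟨x, hxc, Set.Subset.antisymm ?_ ?_⟩
  · intro y hy
    have hyc : y ∈ H.complement := mem_complement.2 fun e he => ((hb y).1 hy e he).ne'
    rw [H.connectedComponentIn_eq_of_signs (x := x) (y := y)
      (fun e he => mul_pos (hx e he) ((hb y).1 hy e he))]
    exact mem_connectedComponentIn hyc
  · intro y hy
    rw [hb]
    intro e he
    by_contra hc
    have hpre : IsPreconnected ((fun z => ⟪e, z⟫) '' connectedComponentIn H.complement x) :=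
      isPreconnected_connectedComponentIn.image _ (by fun_prop)
    have := hpre.ordConnected.out ⟨y, hy, rfl⟩ ⟨x, mem_connectedComponentIn hxc, rfl⟩
      (show (0:ℝ) ∈ Set.Icc ⟪e,y⟫ ⟪e,x⟫ from ⟨not_lt.1 hc, (hx e he).le⟩)
    obtain ⟨z, hz, hz0⟩ := this
    exact mem_complement.1 (connectedComponentIn_subset _ _ hz) e he hz0

/-- The base chamber has sign `1`. -/
theorem sign_baseChamber (H : CentralArrangement V) : H.sign H.baseChamber = 1 := by
  obtain ⟨x, hx⟩ := H.exists_pos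
  have hb : x ∈ H.baseChamber := by simpa [baseChamber, posSide] using hx
  have : H.separationSet H.baseChamber H.baseChamber = ∅ := by
    simp only [separationSet, Finset.filter_eq_empty_iff]
    rintro e he (⟨h1, h2⟩ | ⟨h1, h2⟩)
    · have p : 0 < ⟪e, x⟫ := h1 hb
      have n : ⟪e, x⟫ < 0 := h2 hb
      exact lt_asymm p n
    · have n : ⟪e, x⟫ < 0 := h1 hb
      have p : 0 < ⟪e, x⟫ := h2 hb
      exact lt_asymm p n
  simp [sign, this]

/-- The pizza quantity of `K`: the alternating sum of the volumes of `K ∩ T` over the chambers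
`T` of the arrangement. -/
noncomputable def pizzaQuantity [FiniteDimensional ℝ V] [MeasurableSpace V] [BorelSpace V]
    (H : CentralArrangement V) (K : Set V) : ℝ :=
  ∑ T ∈ H.finite_chambers.toFinset, H.sign T * volume.real (K ∩ T)

end CentralArrangement

/-! Let `B` be the bilinear form of `q` and `n = dim V`. If `q a ≤ R²`, the origin lies in the
ellipsoid, and the line through a unit vector `θ` meets the boundary at the roots `u₊ ≥ 0 ≥ u₋` of
`B θ θ r² - 2 B θ a r - (R² - q a)`. In polar coordinates (`volumeReal_cone_inter_quadBall`) the
cone `C` contributes the integral of `u₊ⁿ / n` over its directions, and `-C`, where the radius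
towards `-θ` is `-u₋`, contributes that of `(-u₋)ⁿ / n`. The sign `(-1)ⁿ` turns the sum into the
integral of the power sum `(u₊ⁿ + u₋ⁿ) / n`. The square roots cancel: power sums are polynomials in
the sum and product of the roots, which are homogeneous of degrees 1 and 2 in `(R, a)` and involve
only `R²`. Integrating coefficients over `θ` gives the polynomial
(`exists_isEvenCoordPolynomial_eval_eq_integral`).

For an arrangement, opposite chambers have signs differing by `(-1)^|E| = (-1)ⁿ` (`sign_neg`), so
the pizza quantity is a combination of such opposite-cone sums (`pizzaQuantity_eq_sum_opposite`). -/

section PowerSum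

variable {A B : Type*} [CommRing A] [CommRing B]

/-- The power sums of the two roots of a monic quadratic polynomial, expressed in the sum `s` and
the product `p` of the roots. -/
def twoPowerSum (s p : A) : ℕ → A
  | 0 => 2
  | 1 => s
  | k + 2 => s * twoPowerSum s p (k + 1) - p * twoPowerSum s p k

theorem twoPowerSum_add_mul (u v : A) : ∀ k, twoPowerSum (u + v) (u * v) k = u ^ k + v ^ k
  | 0 => by simp only [twoPowerSum, pow_zero]; norm_num
  | 1 => by simp [twoPowerSum]
  | k + 2 => by
    rw [twoPowerSum, twoPowerSum_add_mul u v (k + 1), twoPowerSum_add_mul u v k]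
    ring

theorem map_twoPowerSum (f : A →+* B) (s p : A) :
    ∀ k, f (twoPowerSum s p k) = twoPowerSum (f s) (f p) k
  | 0 => map_ofNat f 2
  | 1 => rfl
  | k + 2 => by
    simp only [twoPowerSum, map_sub, map_mul, map_twoPowerSum f s p (k + 1),
      map_twoPowerSum f s p k]

end PowerSum

/-! ### Homogeneous polynomials over a coefficient algebra -/

namespace MvPolynomial

variable {σ A : Type*} [CommRing A]

theorem IsHomogeneous.twoPowerSum {s p : MvPolynomial σ A} (hs : s.IsHomogeneous 1)
    (hp : p.IsHomogeneous 2) : ∀ k, (twoPowerSum s p k).IsHomogeneous k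
  | 0 => isHomogeneous_C σ (2 : A)
  | 1 => hs
  | k + 2 => by
    rw [_root_.twoPowerSum]
    refine IsHomogeneous.sub ?_ ?_
    · convert hs.mul (IsHomogeneous.twoPowerSum hs hp (k + 1)) using 1; ring
    · convert hp.mul (IsHomogeneous.twoPowerSum hs hp k) using 1; ring

/-- A linear functional on the coefficient algebra turns a homogeneous polynomial into a real
homogeneous polynomial with the corresponding values at real points. -/
theorem IsHomogeneous.exists_eval_eq_linearMap [Algebra ℝ A] (L : A →ₗ[ℝ] ℝ) {d : ℕ}
    {P : MvPolynomial σ A} (hP : P.IsHomogeneous d) :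
    ∃ p : MvPolynomial σ ℝ, p.IsHomogeneous d ∧
      ∀ x : σ → ℝ, eval x p = L (eval (fun i => algebraMap ℝ A (x i)) P) := by
  -- Apply `L` coefficientwise; at real points the monomials are scalars and pass through `L`.
  refine ⟨∑ m ∈ P.support, monomial m (L (coeff m P)), ?_, fun x => ?_⟩
  · refine IsHomogeneous.sum _ _ _ fun m hm => isHomogeneous_monomial _ ?_
    rw [Finsupp.degree_eq_weight_one]
    exact hP (mem_support_iff.1 hm)
  · rw [map_sum, eval_eq, map_sum]
    refine Finset.sum_congr rfl fun m _ => ?_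
    rw [eval_monomial, Finsupp.prod]
    simp_rw [← map_pow, ← map_prod]
    rw [mul_comm (coeff m P), ← Algebra.smul_def, map_smul, smul_eq_mul, mul_comm]

end MvPolynomial

/-! ### Volumes in polar coordinates -/

section Polar

variable {V : Type*} [NormedAddCommGroup V] [InnerProductSpace ℝ V]
  [FiniteDimensional ℝ V] [MeasurableSpace V] [BorelSpace V]

theorem volumeIoiPow_setOf_le (n : ℕ) {c : ℝ} (hc : 0 ≤ c) :
    Measure.volumeIoiPow n {r | r.1 ≤ c} = ENNReal.ofReal (c ^ (n + 1) / (n + 1)) := by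
  have him : Subtype.val '' {r : Set.Ioi (0 : ℝ) | r.1 ≤ c} = Set.Ioc 0 c := by
    ext r
    simp [and_comm]
  have hm : MeasurableSet {r : Set.Ioi (0 : ℝ) | r.1 ≤ c} :=
    measurableSet_le measurable_subtype_coe measurable_const
  rw [Measure.volumeIoiPow, withDensity_apply _ hm,
    setLIntegral_subtype measurableSet_Ioi _ fun a : ℝ ↦ .ofReal (a ^ n), him,
    ← ofReal_integral_eq_lintegral_ofReal (intervalIntegral.intervalIntegrable_pow _).1,
    ← intervalIntegral.integral_of_le hc]
  · simp
  · filter_upwards [ae_restrict_mem measurableSet_Ioc] with y hy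
    exact pow_nonneg hy.1.le _

/-- The volume of the part of a star-shaped set with radial function `u` inside a cone. -/
theorem volume_cone_inter_eq_lintegral [Nontrivial V] {C K : Set V} (hC : MeasurableSet C)
    (hK : MeasurableSet K) (hcone : ∀ x, ∀ r : ℝ, 0 < r → (r • x ∈ C ↔ x ∈ C))
    {u : Metric.sphere (0 : V) 1 → ℝ} (hu : ∀ θ, 0 ≤ u θ)
    (huK : ∀ θ : Metric.sphere (0 : V) 1, ∀ r : ℝ, 0 < r → (r • (θ : V) ∈ K ↔ r ≤ u θ)) :
    volume (C ∩ K) = ∫⁻ θ in Subtype.val ⁻¹' C,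
      ENNReal.ofReal (u θ ^ finrank ℝ V / finrank ℝ V) ∂(volume : Measure V).toSphere := by
  have hpos : 0 < finrank ℝ V := finrank_pos
  have hCK := hC.inter hK
  have h0 : MeasurableSet ({0}ᶜ : Set V) := (measurableSet_singleton _).compl
  have hmp := (volume : Measure V).measurePreserving_homeomorphUnitSphereProd
  have h1 : volume (C ∩ K) =
      (volume.comap (Subtype.val : ({0}ᶜ : Set V) → V)) (Subtype.val ⁻¹' (C ∩ K)) := by
    -- Polar coordinates omit the origin, which is a null set.
    rw [comap_subtype_coe_apply h0, Subtype.image_preimage_coe, Set.inter_comm {0}ᶜ,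
      ← Measure.restrict_apply hCK, restrict_compl_singleton]
  set S : Set (Metric.sphere (0 : V) 1 × Set.Ioi (0 : ℝ)) :=
    (homeomorphUnitSphereProd V).symm ⁻¹' (Subtype.val ⁻¹' (C ∩ K)) with hS
  have hSm : MeasurableSet S :=
    (homeomorphUnitSphereProd V).symm.measurable (measurable_subtype_coe hCK)
  have h2 : (Subtype.val ⁻¹' (C ∩ K) : Set ({0}ᶜ : Set V)) = homeomorphUnitSphereProd V ⁻¹' S := by
    ext x; simp [hS]
  rw [h1, h2, hmp.measure_preimage hSm.nullMeasurableSet, Measure.prod_apply hSm,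
    ← lintegral_indicator (measurable_subtype_coe hC)]
  refine lintegral_congr fun θ => ?_
  have hval : ∀ r : Set.Ioi (0 : ℝ), (θ, r) ∈ S ↔ (θ : V) ∈ C ∧ r.1 ≤ u θ := by
    intro r
    simp only [hS, Set.mem_preimage, homeomorphUnitSphereProd_symm_apply_coe, Set.mem_inter_iff,
      hcone _ _ r.2, huK _ _ r.2]
  by_cases hθ : (θ : V) ∈ C
  · rw [Set.indicator_of_mem (by exact hθ)]
    have : Prod.mk θ ⁻¹' S = {r | r.1 ≤ u θ} := by
      ext r; simp [hval, hθ]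
    -- The radial density is `r ^ (n - 1)` with truncated subtraction, hence the need for `0 < n`.
    rw [this, volumeIoiPow_setOf_le _ (hu θ), Nat.sub_add_cancel hpos, Nat.cast_pred hpos,
      sub_add_cancel]
  · rw [Set.indicator_of_notMem (by exact hθ)]
    have : Prod.mk θ ⁻¹' S = ∅ := by
      ext r; simp [hval, hθ]
    rw [this, measure_empty]

theorem volumeReal_cone_inter_eq_integral [Nontrivial V] {C K : Set V} (hC : MeasurableSet C)
    (hK : MeasurableSet K) (hcone : ∀ x, ∀ r : ℝ, 0 < r → (r • x ∈ C ↔ x ∈ C))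
    {u : C(Metric.sphere (0 : V) 1, ℝ)} (hu : ∀ θ, 0 ≤ u θ)
    (huK : ∀ θ : Metric.sphere (0 : V) 1, ∀ r : ℝ, 0 < r → (r • (θ : V) ∈ K ↔ r ≤ u θ)) :
    volume.real (C ∩ K) = ∫ θ in Subtype.val ⁻¹' C,
      u θ ^ finrank ℝ V / finrank ℝ V ∂(volume : Measure V).toSphere := by
  rw [Measure.real, volume_cone_inter_eq_lintegral hC hK hcone hu huK,
    integral_eq_lintegral_of_nonneg_ae]
  · exact .of_forall fun θ => div_nonneg (pow_nonneg (hu θ) _) (Nat.cast_nonneg _)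
  · exact Continuous.aestronglyMeasurable (by fun_prop)

/-- Integration of continuous functions over a part of the unit sphere. -/
noncomputable def sphereIntegral (C : Set V) : C(Metric.sphere (0 : V) 1, ℝ) →ₗ[ℝ] ℝ where
  toFun f := ∫ θ in Subtype.val ⁻¹' C, f θ ∂(volume : Measure V).toSphere
  map_add' f g := by
    have hint : ∀ f : C(Metric.sphere (0 : V) 1, ℝ), Integrable f
        ((volume : Measure V).toSphere.restrict (Subtype.val ⁻¹' C)) := fun f => by
      simpa [IntegrableOn] using f.continuous.continuousOn.integrableOn_compact isCompact_univ
    exact integral_add (hint f) (hint g)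
  map_smul' c f := integral_const_mul c _

end Polar

/-- Multiplied by `α`, the difference of the two sides factors through the roots; as `|β| ≤ s`, the
factor of the nonpositive root is positive for `r > 0`, so the other factor decides the sign. -/
theorem quadratic_le_iff_le_root {α β γ r : ℝ} (hα : 0 < α) (hγ : 0 ≤ γ) (hr : 0 < r) :
    α * r ^ 2 - 2 * β * r ≤ γ ↔ r ≤ (β + √(β ^ 2 + α * γ)) / α := by
  have hD : 0 ≤ β ^ 2 + α * γ := by positivity
  have hs := Real.sq_sqrt hD
  have hs0 := Real.sqrt_nonneg (β ^ 2 + α * γ)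
  set s := √(β ^ 2 + α * γ)
  have hβ : |β| ≤ s := Real.abs_le_sqrt (by nlinarith [mul_nonneg hα.le hγ])
  have hβ' := abs_le.1 hβ
  rw [le_div_iff₀ hα]
  have key : α * (α * r ^ 2 - 2 * β * r - γ) = (r * α - β - s) * (r * α - β + s) := by
    linear_combination hs
  have hpos : 0 < r * α - β + s := by nlinarith [mul_pos hr hα]
  constructor
  · intro h
    by_contra! hc
    have : 0 < (r * α - β - s) * (r * α - β + s) := mul_pos (by linarith) hpos
    nlinarith
  · intro h
    have : (r * α - β - s) * (r * α - β + s) ≤ 0 :=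
      mul_nonpos_of_nonpos_of_nonneg (by linarith) hpos.le
    by_contra! hc
    nlinarith

/-! ### The polynomial attached to a pair of opposite cones -/

section ConePolynomial

variable {V : Type*} [NormedAddCommGroup V] [InnerProductSpace ℝ V] [FiniteDimensional ℝ V]

variable (V) in
/-- The coordinate forms on `ℝ × V` with respect to an orthonormal basis of `V`. -/
noncomputable def coordForms : Fin (finrank ℝ V + 1) → Dual ℝ (ℝ × V) :=
  Fin.cons (LinearMap.fst ℝ ℝ V)
    fun i => (stdOrthonormalBasis ℝ V).toBasis.coord i ∘ₗ LinearMap.snd ℝ ℝ V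

theorem coordForms_zero (w : ℝ × V) : coordForms V 0 w = w.1 := rfl

theorem coordForms_succ (w : ℝ × V) (i : Fin (finrank ℝ V)) :
    coordForms V i.succ w = (stdOrthonormalBasis ℝ V).toBasis.repr w.2 i := rfl

/-- The homogeneous polynomial functions of degree `dim V` on `ℝ × V`, even in the first
variable, written in the coordinates `coordForms`. -/
structure IsEvenCoordPolynomial (p : MvPolynomial (Fin (finrank ℝ V + 1)) ℝ) : Prop where
  isHomogeneous : p.IsHomogeneous (finrank ℝ V)
  even : ∀ (R : ℝ) (a : V), MvPolynomial.eval (fun i => coordForms V i (R, a)) p =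
    MvPolynomial.eval (fun i => coordForms V i (-R, a)) p

/-- Fixing the coordinate forms once lets polynomials from different chambers be added. -/
theorem IsEvenCoordPolynomial.sum {ι : Type*} (s : Finset ι) (c : ι → ℝ)
    {p : ι → MvPolynomial (Fin (finrank ℝ V + 1)) ℝ}
    (hp : ∀ i ∈ s, IsEvenCoordPolynomial (V := V) (p i)) :
    IsEvenCoordPolynomial (V := V) (∑ i ∈ s, MvPolynomial.C (c i) * p i) where
  isHomogeneous := .sum _ _ _ fun i hi => (hp i hi).isHomogeneous.C_mul _
  even R a := by
    simp only [map_sum, map_mul, MvPolynomial.eval_C]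
    exact Finset.sum_congr rfl fun i hi => by rw [(hp i hi).even]

variable [MeasurableSpace V] [BorelSpace V]

/-- The integrand is a polynomial in `(R, a)` whose coefficients are continuous functions on the
sphere, so `sphereIntegral` can be applied to the coefficients. -/
theorem exists_isEvenCoordPolynomial_eval_eq_integral (B : V →L[ℝ] V →L[ℝ] ℝ)
    (hB : ∀ x, x ≠ 0 → 0 < B x x) (C : Set V) :
    ∃ p : MvPolynomial (Fin (finrank ℝ V + 1)) ℝ, IsEvenCoordPolynomial (V := V) p ∧
      ∀ (R : ℝ) (a : V), MvPolynomial.eval (fun i => coordForms V i (R, a)) p =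
        ∫ θ : Metric.sphere (0 : V) 1 in Subtype.val ⁻¹' C,
          twoPowerSum (2 * B θ a / B θ θ) ((B a a - R ^ 2) / B θ θ) (finrank ℝ V)
          ∂(volume : Measure V).toSphere := by
  set b := (stdOrthonormalBasis ℝ V).toBasis
  have hθ : ∀ θ : Metric.sphere (0 : V) 1, B θ θ ≠ 0 := fun θ =>
    (hB θ (ne_zero_of_mem_unit_sphere θ)).ne'
  let κ : C(Metric.sphere (0 : V) 1, ℝ) := ⟨fun θ => (B θ θ)⁻¹, by fun_prop (disch := exact hθ _)⟩
  let c (i : Fin (finrank ℝ V)) : C(Metric.sphere (0 : V) 1, ℝ) :=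
    ⟨fun θ => 2 * B θ (b i) * (B θ θ)⁻¹, by fun_prop (disch := exact hθ _)⟩
  let s : MvPolynomial (Fin (finrank ℝ V + 1)) C(Metric.sphere (0 : V) 1, ℝ) :=
    ∑ i, MvPolynomial.C (c i) * MvPolynomial.X i.succ
  let t : MvPolynomial (Fin (finrank ℝ V + 1)) C(Metric.sphere (0 : V) 1, ℝ) :=
    MvPolynomial.C κ * (∑ i, ∑ j, MvPolynomial.C (algebraMap ℝ _ (B (b i) (b j))) *
      (MvPolynomial.X i.succ * MvPolynomial.X j.succ) - MvPolynomial.X 0 ^ 2)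
  have hs : s.IsHomogeneous 1 :=
    .sum _ _ _ fun i _ => MvPolynomial.isHomogeneous_C_mul_X _ _
  have ht : t.IsHomogeneous 2 := by
    refine MvPolynomial.IsHomogeneous.C_mul (.sub (.sum _ _ _ fun i _ => .sum _ _ _ fun j _ =>
      MvPolynomial.IsHomogeneous.C_mul ?_ _) (MvPolynomial.isHomogeneous_X_pow _ _)) _
    exact (MvPolynomial.isHomogeneous_X _ _).mul (MvPolynomial.isHomogeneous_X _ _)
  obtain ⟨p, hp, hpe⟩ := (hs.twoPowerSum ht (finrank ℝ V)).exists_eval_eq_linearMap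
    (sphereIntegral C)
  have heval : ∀ (R : ℝ) (a : V), MvPolynomial.eval (fun i => coordForms V i (R, a)) p =
      ∫ θ : Metric.sphere (0 : V) 1 in Subtype.val ⁻¹' C,
        twoPowerSum (2 * B θ a / B θ θ) ((B a a - R ^ 2) / B θ θ) (finrank ℝ V)
        ∂(volume : Measure V).toSphere := by
    intro R a
    rw [hpe]
    refine integral_congr_ae (.of_forall fun θ => ?_)
    -- Evaluation at `θ` as a ring homomorphism, so that it commutes with `twoPowerSum`.
    have hcomp : ∀ f : C(Metric.sphere (0 : V) 1, ℝ), f θ =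
      (Pi.evalRingHom (fun _ => ℝ) θ).comp ContinuousMap.coeFnRingHom f := fun _ => rfl
    have ha : ∑ i, b.repr a i • b i = a := b.sum_repr a
    have h1 : B θ a = ∑ i, b.repr a i * B θ (b i) := by
      conv_lhs => rw [← ha]
      simp only [map_sum, map_smul, smul_eq_mul]
    have h2 : B a a = ∑ i, ∑ j, B (b i) (b j) * (b.repr a i * b.repr a j) := by
      conv_lhs => rw [← ha]
      simp only [map_sum, map_smul, sum_apply, smul_apply, smul_eq_mul, Finset.mul_sum]
      rw [Finset.sum_comm]
      exact Finset.sum_congr rfl fun _ _ => Finset.sum_congr rfl fun _ _ => by ring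
    simp only [map_twoPowerSum, hcomp]
    congr 1
    · simp only [s, map_sum, map_mul, MvPolynomial.eval_C, MvPolynomial.eval_X, ← hcomp,
        coordForms_succ, h1, Finset.mul_sum, Finset.sum_div, ContinuousMap.sum_apply]
      refine Finset.sum_congr rfl fun i _ => ?_
      simp only [c, b, ContinuousMap.mul_apply, ContinuousMap.coe_mk, algebraMap_apply,
        smul_eq_mul, mul_one]
      ring
    · simp only [t, map_sum, map_sub, map_pow, map_mul, MvPolynomial.eval_C, MvPolynomial.eval_X,
        ← hcomp, coordForms_succ, coordForms_zero, h2]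
      simp only [κ, b, ContinuousMap.mul_apply, ContinuousMap.sub_apply, ContinuousMap.sum_apply,
        ContinuousMap.pow_apply, ContinuousMap.coe_mk, algebraMap_apply, smul_eq_mul, mul_one]
      ring
  refine ⟨p, ⟨hp, fun R a => ?_⟩, heval⟩
  rw [heval, heval, neg_sq]

theorem volumeReal_cone_inter_quadBall [Nontrivial V] (q : QuadraticForm ℝ V)
    (B : V →L[ℝ] V →L[ℝ] ℝ) (hBq : ∀ x, B x x = q x) (hsymm : ∀ x y, B x y = B y x)
    (hB : ∀ x, x ≠ 0 → 0 < B x x) {C : Set V} (hC : MeasurableSet C)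
    (hcone : ∀ x, ∀ r : ℝ, 0 < r → (r • x ∈ C ↔ x ∈ C)) {R : ℝ} {a : V} (ha : q a ≤ R ^ 2) :
    volume.real (C ∩ quadBall q a R) = ∫ θ : Metric.sphere (0 : V) 1 in Subtype.val ⁻¹' C,
      ((B θ a + √(B θ a ^ 2 + B θ θ * (R ^ 2 - B a a))) / B θ θ) ^ finrank ℝ V / finrank ℝ V
      ∂(volume : Measure V).toSphere := by
  have hθ : ∀ θ : Metric.sphere (0 : V) 1, 0 < B θ θ := fun θ =>
    hB θ (ne_zero_of_mem_unit_sphere θ)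
  rw [← hBq] at ha
  have hK : IsClosed (quadBall q a R) := by
    simp only [quadBall, ← hBq]
    exact isClosed_le (by fun_prop) continuous_const
  let u : C(Metric.sphere (0 : V) 1, ℝ) :=
    ⟨fun θ => (B θ a + √(B θ a ^ 2 + B θ θ * (R ^ 2 - B a a))) / B θ θ,
      by fun_prop (disch := exact fun θ => (hθ θ).ne')⟩
  refine volumeReal_cone_inter_eq_integral (u := u) hC hK.measurableSet hcone (fun θ => ?_)
    fun θ r hr => ?_
  · refine div_nonneg ?_ (hθ θ).le
    have : |B θ a| ≤ √(B θ a ^ 2 + B θ θ * (R ^ 2 - B a a)) :=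
      Real.abs_le_sqrt (by nlinarith [mul_nonneg (hθ θ).le (sub_nonneg.2 ha)])
    linarith [neg_abs_le (B θ a)]
  · refine Iff.trans ?_ (quadratic_le_iff_le_root (hθ θ) (sub_nonneg.2 ha) hr)
    simp only [quadBall, Set.mem_ofPred_eq, ← hBq, map_sub, map_smul, sub_apply, smul_apply,
      smul_eq_mul, hsymm a θ]
    constructor <;> intro h <;> linarith

/-- The alternating sum of the volumes of the parts of an ellipsoid in opposite cones. -/
theorem exists_isEvenCoordPolynomial_volumeReal_cone (q : QuadraticForm ℝ V) (hq : q.PosDef)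
    {C : Set V} (hC : MeasurableSet C)
    (hcone : ∀ x, ∀ r : ℝ, 0 < r → (r • x ∈ C ↔ x ∈ C)) :
    ∃ p : MvPolynomial (Fin (finrank ℝ V + 1)) ℝ, IsEvenCoordPolynomial (V := V) p ∧
      ∀ (R : ℝ) (a : V), q a ≤ R ^ 2 →
        volume.real (C ∩ quadBall q a R) + (-1) ^ finrank ℝ V *
          volume.real (-C ∩ quadBall q a R) =
        MvPolynomial.eval (fun i => coordForms V i (R, a)) p := by
  rcases subsingleton_or_nontrivial V with hV | hV
  -- In dimension zero the unit sphere is empty; here `-C = C` and the ball is all of `V`.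
  · have hn : finrank ℝ V = 0 := finrank_zero_of_subsingleton
    refine ⟨MvPolynomial.C (2 * volume.real C), ⟨?_, fun _ _ => by simp⟩, fun R a _ => ?_⟩
    · rw [hn]; exact MvPolynomial.isHomogeneous_C _ _
    · have hb : quadBall q a R = Set.univ := by
        ext x
        simp [quadBall, Subsingleton.elim (x - a) 0, sq_nonneg]
      have hneg : -C = C := by
        ext x
        rw [Set.mem_neg, Subsingleton.elim (-x) x]
      simp only [hb, hneg, MvPolynomial.eval_C, Set.inter_univ, hn, pow_zero]
      ring
  set B : V →L[ℝ] V →L[ℝ] ℝ := (QuadraticMap.associated q).toContinuousBilinearMap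
  have hBq : ∀ x, B x x = q x := fun x => QuadraticMap.associated_eq_self_apply ℝ q x
  have hsymm : ∀ x y, B x y = B y x := fun x y => QuadraticMap.associated_isSymm ℝ q x y
  have hB : ∀ x, x ≠ 0 → 0 < B x x := fun x hx => by rw [hBq]; exact hq x hx
  obtain ⟨p, hp, hpe⟩ := exists_isEvenCoordPolynomial_eval_eq_integral B hB C
  -- A one-term sum, so that `IsEvenCoordPolynomial.sum` covers scaling by `1 / n`.
  refine ⟨∑ _i : Unit, MvPolynomial.C (1 / (finrank ℝ V : ℝ)) * p, .sum _ _ fun _ _ => hp,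
    fun R a ha => ?_⟩
  -- Reflecting in the origin moves the sign from the cone to the centre, so both integrals run over
  -- the same directions.
  have hneg : volume.real (-C ∩ quadBall q a R) = volume.real (C ∩ quadBall q (-a) R) := by
    rw [Measure.real, ← Measure.measure_neg, Set.inter_neg, neg_neg, Measure.real]
    congr 2
    ext x
    refine and_congr_right fun _ => ?_
    rw [Set.mem_neg]
    simp only [quadBall, Set.mem_ofPred_eq]
    rw [← QuadraticMap.map_neg]
    congr! 2
    abel
  have ha' : q (-a) ≤ R ^ 2 := by rwa [QuadraticMap.map_neg]
  have hθ : ∀ θ : Metric.sphere (0 : V) 1, 0 < B θ θ := fun θ =>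
    hB θ (ne_zero_of_mem_unit_sphere θ)
  let u (a : V) : C(Metric.sphere (0 : V) 1, ℝ) :=
    ⟨fun θ => ((B θ a + √(B θ a ^ 2 + B θ θ * (R ^ 2 - B a a))) / B θ θ) ^ finrank ℝ V /
      finrank ℝ V, by fun_prop (disch := exact fun θ => (hθ θ).ne')⟩
  have hu : ∀ a : V, q a ≤ R ^ 2 → volume.real (C ∩ quadBall q a R) = sphereIntegral C (u a) :=
    fun a ha => volumeReal_cone_inter_quadBall q B hBq hsymm hB hC hcone ha
  rw [hneg, hu a ha, hu (-a) ha', ← smul_eq_mul, ← map_smul, ← map_add, Fintype.sum_unique,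
    map_mul, MvPolynomial.eval_C, hpe, ← integral_const_mul]
  refine integral_congr_ae (.of_forall fun θ => ?_)
  have hα := hθ θ
  have hD : 0 ≤ B θ a ^ 2 + B θ θ * (R ^ 2 - B a a) := by
    have : 0 ≤ B θ θ * (R ^ 2 - B a a) := mul_nonneg hα.le (by rw [hBq]; linarith)
    positivity
  have hs := Real.sq_sqrt hD
  simp only [ContinuousMap.add_apply, ContinuousMap.smul_apply, u, ContinuousMap.coe_mk, map_neg,
    neg_apply, neg_neg, neg_sq, smul_eq_mul]
  set D := √(B θ a ^ 2 + B θ θ * (R ^ 2 - B a a))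
  -- The two roots are the radius for `a` and minus the radius for `-a`.
  have hsum : 2 * B θ a / B θ θ = (B θ a + D) / B θ θ + -((-B θ a + D) / B θ θ) := by ring
  have hprod : (B a a - R ^ 2) / B θ θ = (B θ a + D) / B θ θ * -((-B θ a + D) / B θ θ) := by
    field_simp
    linear_combination hs
  rw [hsum, hprod, twoPowerSum_add_mul, neg_pow ((-B θ a + D) / B θ θ)]
  ring

end ConePolynomial

/-! ### Chambers and their opposites -/

namespace CentralArrangement

variable {V : Type*} [NormedAddCommGroup V] [InnerProductSpace ℝ V] (H : CentralArrangement V)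

/-- A form `⟪e, ·⟫` that changed sign on a connected set would vanish on it, by the intermediate
value property. -/
theorem connectedComponentIn_complement_eq {x : V} (hx : x ∈ H.complement) :
    connectedComponentIn H.complement x = {y | ∀ e ∈ H.normals, 0 < ⟪e, x⟫ * ⟪e, y⟫} := by
  ext y
  refine ⟨fun hy e he => ?_, fun hy => ?_⟩
  · by_contra hc
    have hpre : IsPreconnected
        ((fun z => ⟪e, x⟫ * ⟪e, z⟫) '' connectedComponentIn H.complement x) :=
      isPreconnected_connectedComponentIn.image _ (by fun_prop)
    obtain ⟨z, hz, hz0⟩ := hpre.ordConnected.out ⟨y, hy, rfl⟩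
      ⟨x, mem_connectedComponentIn hx, rfl⟩
      (show (0 : ℝ) ∈ Set.Icc (⟪e, x⟫ * ⟪e, y⟫) (⟪e, x⟫ * ⟪e, x⟫) from
        ⟨not_lt.1 hc, mul_self_nonneg _⟩)
    rcases mul_eq_zero.1 hz0 with h | h
    · exact mem_complement.1 hx e he h
    · exact mem_complement.1 (connectedComponentIn_subset _ _ hz) e he h
  · rw [H.connectedComponentIn_eq_of_signs hy]
    exact mem_connectedComponentIn (mem_complement.2 fun e he => right_ne_zero_of_mul (hy e he).ne')

theorem neg_mem_complement {x : V} (hx : x ∈ H.complement) : -x ∈ H.complement := by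
  rw [mem_complement] at hx ⊢
  simpa using hx

theorem neg_connectedComponentIn {x : V} (hx : x ∈ H.complement) :
    -connectedComponentIn H.complement x = connectedComponentIn H.complement (-x) := by
  rw [H.connectedComponentIn_complement_eq hx,
    H.connectedComponentIn_complement_eq (H.neg_mem_complement hx)]
  ext y
  simp

theorem neg_mem_chambers {T : Set V} (hT : T ∈ H.chambers) : -T ∈ H.chambers := by
  obtain ⟨x, hx, rfl⟩ := hT
  exact ⟨-x, H.neg_mem_complement hx, H.neg_connectedComponentIn hx⟩

theorem isOpen_of_mem_chambers {T : Set V} (hT : T ∈ H.chambers) : IsOpen T := by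
  obtain ⟨x, hx, rfl⟩ := hT
  have : {y | ∀ e ∈ H.normals, 0 < ⟪e, x⟫ * ⟪e, y⟫} =
      ⋂ e ∈ H.normals, {y | 0 < ⟪e, x⟫ * ⟪e, y⟫} := by
    ext; simp
  rw [H.connectedComponentIn_complement_eq hx, this]
  exact isOpen_biInter_finset fun e _ => isOpen_lt continuous_const (by fun_prop)

theorem smul_mem_iff_of_mem_chambers {T : Set V} (hT : T ∈ H.chambers) (y : V) {r : ℝ}
    (hr : 0 < r) : r • y ∈ T ↔ y ∈ T := by
  obtain ⟨x, hx, rfl⟩ := hT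
  rw [H.connectedComponentIn_complement_eq hx]
  refine forall₂_congr fun e _ => ?_
  rw [inner_smul_right, mul_left_comm, mul_pos_iff_of_pos_left hr]

theorem separates_baseChamber_iff {x : V} (hx : x ∈ H.complement) {e : V} (he : e ∈ H.normals) :
    Separates e H.baseChamber (connectedComponentIn H.complement x) ↔ ⟪e, x⟫ < 0 := by
  obtain ⟨z, hz⟩ := H.exists_pos
  have hzb : z ∈ H.baseChamber := by simpa [baseChamber, posSide] using hz
  constructor
  · rintro (⟨-, h⟩ | ⟨h, -⟩)
    · exact h (mem_connectedComponentIn hx)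
    · exact absurd (h hzb) (hz e he).not_gt
  · refine fun h => Or.inl ⟨Set.biInter_subset_of_mem he, fun y hy => ?_⟩
    rw [H.connectedComponentIn_complement_eq hx] at hy
    exact neg_of_mul_pos_right (hy e he) h.le

/-- The hyperplanes separating `-T` from the base chamber are exactly those that do not separate `T`
from it. -/
theorem sign_neg {T : Set V} (hT : T ∈ H.chambers) :
    H.sign (-T) = (-1) ^ H.normals.card * H.sign T := by
  classical
  obtain ⟨x, hx, rfl⟩ := hT
  have hsep : ∀ y ∈ H.complement,
      H.separationSet H.baseChamber (connectedComponentIn H.complement y) =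
        H.normals.filter fun e => ⟪e, y⟫ < 0 := fun y hy =>
    Finset.filter_congr fun e he => H.separates_baseChamber_iff hy he
  rw [H.neg_connectedComponentIn hx, sign, sign, hsep x hx, hsep _ (H.neg_mem_complement hx)]
  have hcompl : (H.normals.filter fun e => ⟪e, -x⟫ < 0) =
      H.normals.filter fun e => ¬ ⟪e, x⟫ < 0 := by
    refine Finset.filter_congr fun e he => ?_
    have := mem_complement.1 hx e he
    rw [inner_neg_right, neg_lt_zero, not_lt]
    exact ⟨le_of_lt, fun h => lt_of_le_of_ne h this.symm⟩
  rw [hcompl, ← Finset.card_filter_add_card_filter_not (s := H.normals) (fun e => ⟪e, x⟫ < 0),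
    pow_add, mul_right_comm, ← mul_pow]
  simp

theorem pizzaQuantity_eq_sum_opposite [FiniteDimensional ℝ V] [MeasurableSpace V] [BorelSpace V]
    (hH : H.normals.card ≡ finrank ℝ V [MOD 2]) (K : Set V) :
    H.pizzaQuantity K = ∑ T ∈ H.finite_chambers.toFinset, H.sign T / 2 *
      (volume.real (T ∩ K) + (-1) ^ finrank ℝ V * volume.real (-T ∩ K)) := by
  have hsgn : (-1 : ℝ) ^ H.normals.card = (-1) ^ finrank ℝ V := by
    rw [neg_one_pow_eq_pow_mod_two, hH, ← neg_one_pow_eq_pow_mod_two]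
  have hneg : ∑ T ∈ H.finite_chambers.toFinset, H.sign T * volume.real (K ∩ T) =
      ∑ T ∈ H.finite_chambers.toFinset, H.sign (-T) * volume.real (K ∩ -T) := by
    refine Finset.sum_equiv (Equiv.neg (Set V)) (fun T => ?_) fun T _ => ?_
    · simp only [Set.Finite.mem_toFinset, Equiv.neg_apply]
      exact ⟨H.neg_mem_chambers, fun h => neg_neg T ▸ H.neg_mem_chambers h⟩
    · simp
  -- Average the sum with its reindexing by `T ↦ -T`.
  have htwo : H.pizzaQuantity K = (H.pizzaQuantity K + H.pizzaQuantity K) / 2 := by ring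
  rw [htwo]
  nth_rw 2 [pizzaQuantity]
  rw [hneg, pizzaQuantity, ← Finset.sum_add_distrib, Finset.sum_div]
  refine Finset.sum_congr rfl fun T hT => ?_
  rw [H.sign_neg (H.finite_chambers.mem_toFinset.1 hT), hsgn, Set.inter_comm K, Set.inter_comm K]
  ring

end CentralArrangement

/-! ### Polyhedral cones and arrangements -/

theorem theorem7p2 {V : Type*} [NormedAddCommGroup V] [InnerProductSpace ℝ V]
    [FiniteDimensional ℝ V] [MeasurableSpace V] [BorelSpace V]
    (q : QuadraticForm ℝ V) (hq : q.PosDef) :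
    (∀ C : PointedCone ℝ V, C.DualFG (innerₗ V) →
      ∃ g : ℝ × V → ℝ,
        IsHomogeneousPolynomialFun (finrank ℝ V) g ∧
        (∀ (R : ℝ) (a : V), g (R, a) = g (-R, a)) ∧
        ∀ (R : ℝ) (a : V), q a ≤ R ^ 2 →
          volume.real ((C : Set V) ∩ quadBall q a R) +
            (-1) ^ finrank ℝ V * volume.real (-(C : Set V) ∩ quadBall q a R) = g (R, a)) ∧
    (∀ H : CentralArrangement V, H.normals.card ≡ finrank ℝ V [MOD 2] →
      ∃ g : ℝ × V → ℝ,
        IsHomogeneousPolynomialFun (finrank ℝ V) g ∧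
        (∀ (R : ℝ) (a : V), g (R, a) = g (-R, a)) ∧
        ∀ (R : ℝ) (a : V), q a ≤ R ^ 2 →
          H.pizzaQuantity (quadBall q a R) = g (R, a)) := by
  refine ⟨fun C hC => ?_, fun H hH => ?_⟩
  · have hclosed : IsClosed (C : Set V) := by
      obtain ⟨s, rfl⟩ := hC
      have : (PointedCone.dual (innerₗ V) (s : Set V) : Set V) = ⋂ e ∈ s, {x | 0 ≤ ⟪e, x⟫} := by
        ext x; simp
      rw [this]
      exact isClosed_biInter fun e _ => isClosed_le continuous_const (by fun_prop)
    obtain ⟨p, hp, hpe⟩ := exists_isEvenCoordPolynomial_volumeReal_cone q hq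
      hclosed.measurableSet fun x r hr => by
        refine ⟨fun h => ?_, fun h => C.smul_mem hr.le h⟩
        have := C.smul_mem (inv_pos.2 hr).le h
        rwa [inv_smul_smul₀ hr.ne'] at this
    exact ⟨_, ⟨_, coordForms V, p, hp.isHomogeneous, fun _ => rfl⟩, hp.even, hpe⟩
  · have hcone : ∀ T ∈ H.finite_chambers.toFinset,
        ∃ p : MvPolynomial (Fin (finrank ℝ V + 1)) ℝ, IsEvenCoordPolynomial (V := V) p ∧
          ∀ (R : ℝ) (a : V), q a ≤ R ^ 2 → volume.real (T ∩ quadBall q a R) +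
            (-1) ^ finrank ℝ V * volume.real (-T ∩ quadBall q a R) =
              MvPolynomial.eval (fun i => coordForms V i (R, a)) p := fun T hT => by
      rw [Set.Finite.mem_toFinset] at hT
      exact exists_isEvenCoordPolynomial_volumeReal_cone q hq
        (H.isOpen_of_mem_chambers hT).measurableSet
        fun x _ hr => H.smul_mem_iff_of_mem_chambers hT x hr
    choose! p hp hpe using hcone
    have hsum := IsEvenCoordPolynomial.sum _ (fun T => H.sign T / 2) hp
    refine ⟨_, ⟨_, coordForms V, _, hsum.isHomogeneous, fun _ => rfl⟩, hsum.even,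
      fun R a ha => ?_⟩
    rw [H.pizzaQuantity_eq_sum_opposite hH, map_sum]
    exact Finset.sum_congr rfl fun T hT => by
      rw [map_mul, MvPolynomial.eval_C, hpe T hT R a ha]
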